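/- **Convergence of smoothed Q-learning.** Consider a finite Markov decision process: a finite state set $S$, a finite non-empty action set $A(s)$ for each state $s$, transition probabilities $p(s'\mid s,a)$, for each $(s,a,s')$ a probability law $\rho(\cdot\mid s,a,s')$ on $\mathbb R$ of the stochastic reward, all supported in one bounded interval, with mean $\bar r(s,a,s')$, and a discount factor $0\le\gamma<1$. Let $(\mathcal F_t)_{t\ge 0}$ be a filtration on a probability space. At each time $t$ a state-action pair $(s_t,a_t)$ is visited, chosen in an arbitrary $\mathcal F_t$-measurable way (no policy is prescribed). A successor state $s'_t$ and a reward $r_t$, both $\mathcal F_{t+1}$-measurable, are then observed, with $$\mathbb P(s'_t=s',\,r_t\in B\mid\mathcal F_t)=p(s'\mid s_t,a_t)\,\rho(B\mid s_t,a_t,s')\quad\text{a.s.}$$ for all $s'\in S$ and Borel $B\subseteq\mathbb R$. (A single trajectory is the case $s_{t+1}=s'_t$; restarts are allowed.) Starting from an arbitrary $\mathcal F_0$-measurable real table $\tilde Q_0$, run smoothed Q-learning $$\tilde Q_{t+1}(s_t,a_t)=\tilde Q_t(s_t,a_t)+\alpha_t(s_t,a_t)\Big(r_t+\gamma\sum_{a}q_t(a\mid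 s'_t)\,\tilde Q_t(s'_t,a)-\tilde Q_t(s_t,a_t)\Big),$$ all other entries being left unchanged. Here, for every $(s,a)$, $\alpha_t(s,a)$ and $q_t(a\mid s)$ are $\mathcal F_t$-measurable, $q_t(\cdot\mid s)$ is a probability distribution on $A(s)$, and almost surely $0\le\alpha_t(s,a)\le1$ for all $t$. Assume that every pair is visited often enough that, almost surely, for every $(s,a)$, $$\sum_{t:\,(s_t,a_t)=(s,a)}\alpha_t(s,a)=\infty,\qquad \sum_{t:\,(s_t,a_t)=(s,a)}\alpha_t(s,a)^2<\infty$$ (in particular every pair is visited infinitely often). Assume finally that one of the following holds, where the relation stated for $q_t$ is required almost surely, for all $t$ and all $s$: 1. (concentration) there are random $\delta_t\to0$ almost surely such that $q_t(\cdot\mid s)$ places total mass at least $1-\delta_t$ on the actions maximizing $\tilde Q_t(s,\cdot)$; 2. (softmax) $q_t(a\mid s)=e^{\beta_t\tilde Q_t(s,a)}\big/\sum_b e^{\beta_t\tilde Q_t(s,b)}$ for all $a$, with random $\beta_t\to\infty$ almost surely; 3. (clipped max) there are random $\delta_t\to0$ almost surely such that $q_t(\cdot\mid s)$ places mass $1-\delta_t$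 on one maximizer of $\tilde Q_t(s,\cdot)$ and mass $\delta_t/(|A(s)|-1)$ on each other action (if $|A(s)|=1$, all mass is on the only action). Then the optimality equation $$Q_*(s,a)=\sum_{s'}p(s'\mid s,a)\big(\bar r(s,a,s')+\gamma\max_b Q_*(s',b)\big)$$ has exactly one solution $Q_*$, and almost surely $\tilde Q_t(s,a)\to Q_*(s,a)$ as $t\to\infty$ for all $s$ and $a$. -/

import Mathlib

open MeasureTheory ProbabilityTheory Filter Topology

/-- A finite discounted Markov decision process with states `S` and, in state `s`, the actions
`A s`: transition probabilities `p s a s'`, the law `ρ s a s'` of the (bounded, stochastic) reward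
received on the transition from `s` to `s'` under `a`, and a discount factor `γ < 1`. -/
structure FiniteMDP (S : Type*) [Fintype S] (A : S → Type*) where
  p : (s : S) → A s → S → ℝ
  p_mem : ∀ s a, p s a ∈ stdSimplex ℝ S
  ρ : (s : S) → A s → S → Measure ℝ
  ρ_prob : ∀ s a s', IsProbabilityMeasure (ρ s a s')
  ρ_bounded : ∃ R : ℝ, ∀ s a s', ∀ᵐ x ∂(ρ s a s'), |x| ≤ R
  γ : ℝ
  γ_nonneg : 0 ≤ γ
  γ_lt_one : γ < 1

section

variable {S : Type*} [Fintype S] {A : S → Type*}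

/-- `Qs` solves the optimality equation
`Q(s,a) = ∑ s', p(s'|s,a) (E[r(s'|s,a)] + γ max_b Q(s',b))`. -/
def FiniteMDP.IsOptimalQ (M : FiniteMDP S A) (Qs : (s : S) → A s → ℝ) : Prop :=
  ∀ s a, Qs s a = ∑ s', M.p s a s' * ((∫ x, x ∂(M.ρ s a s')) + M.γ * ⨆ b, Qs s' b)

/-- The sampling mechanism. At time `t` the pair `Z t = (s_t, a_t)` is chosen in any way from the
past `ℱ t` (no policy is prescribed); then a successor state `Y t` and a reward `r t` are drawn:
given `ℱ t`, the pair `(Y t, r t)` has the law `p(s'|s_t,a_t) ρ(dx|s_t,a_t,s')`.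
A single trajectory is the case where the state component of `Z (t+1)` is `Y t`; restarts are
allowed as well. -/
structure FiniteMDP.IsSampling (M : FiniteMDP S A) {Ω : Type*} {mΩ : MeasurableSpace Ω}
    (μ : Measure Ω) (ℱ : Filtration ℕ mΩ) (Z : ℕ → Ω → (Σ s, A s)) (Y : ℕ → Ω → S)
    (r : ℕ → Ω → ℝ) : Prop where
  measurable_pair : ∀ t z, MeasurableSet[ℱ t] {ω | Z t ω = z}
  measurable_next : ∀ t s', MeasurableSet[ℱ (t + 1)] {ω | Y t ω = s'}
  measurable_reward : ∀ t, Measurable[ℱ (t + 1)] (r t)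
  cond_law : ∀ (t : ℕ) (s' : S) (B : Set ℝ), MeasurableSet B →
    μ⟦{ω | Y t ω = s' ∧ r t ω ∈ B} | ℱ t⟧ =ᵐ[μ]
      fun ω => M.p (Z t ω).1 (Z t ω).2 s' * (M.ρ (Z t ω).1 (Z t ω).2 s').real B

open Classical in
/-- The step size actually applied to the pair `(s,a)` at time `t`: it is `α_t(s,a)` if `(s,a)` is
the pair visited at time `t`, and `0` otherwise. -/
noncomputable def appliedStep {Ω : Type*} (Z : ℕ → Ω → (Σ s, A s))
    (α : ℕ → Ω → (s : S) → A s → ℝ) (t : ℕ) (ω : Ω) (s : S) (a : A s) : ℝ :=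
  if Z t ω = ⟨s, a⟩ then α t ω s a else 0

/-- The smoothed Q-learning recursion, in which only the visited entry is changed. -/
def IsSmoothedQLearning [∀ s, Fintype (A s)] {Ω : Type*} (γ : ℝ) (Z : ℕ → Ω → (Σ s, A s))
    (Y : ℕ → Ω → S) (r : ℕ → Ω → ℝ) (α : ℕ → Ω → (s : S) → A s → ℝ)
    (q Q : ℕ → Ω → (s : S) → A s → ℝ) : Prop :=
  ∀ t ω s a, Q (t + 1) ω s a = Q t ω s a + appliedStep Z α t ω s a *
    (r t ω + γ * (∑ b, q t ω (Y t ω) b * Q t ω (Y t ω) b) - Q t ω s a)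

/-- `a` maximizes the action values `v`. -/
def IsGreedy {B : Type*} (v : B → ℝ) (a : B) : Prop := ∀ b, v b ≤ v a

open Classical in
/-- In every state, `q_t` places at least mass `1 - δ_t` on the greedy (maximizing) actions of
`Q_t`, where `δ_t → 0` almost surely. -/
def ConcentratesOnGreedy [∀ s, Fintype (A s)] {Ω : Type*} {mΩ : MeasurableSpace Ω}
    (μ : Measure Ω) (q Q : ℕ → Ω → (s : S) → A s → ℝ) : Prop :=
  ∃ δ : ℕ → Ω → ℝ, ∀ᵐ ω ∂μ, Tendsto (fun t => δ t ω) atTop (𝓝 0) ∧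
    ∀ t s, 1 - δ t ω ≤ ∑ a with IsGreedy (Q t ω s) a, q t ω s a

/-- `q_t(a|s) ∝ exp(β_t Q_t(s,a))` with `β_t → ∞` almost surely. -/
def IsSharpeningSoftmax [∀ s, Fintype (A s)] {Ω : Type*} {mΩ : MeasurableSpace Ω}
    (μ : Measure Ω) (q Q : ℕ → Ω → (s : S) → A s → ℝ) : Prop :=
  ∃ β : ℕ → Ω → ℝ, ∀ᵐ ω ∂μ, Tendsto (fun t => β t ω) atTop atTop ∧
    ∀ t s a, q t ω s a =
      Real.exp (β t ω * Q t ω s a) / ∑ b, Real.exp (β t ω * Q t ω s b)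

/-- `q_t` places mass `1 - δ_t` on one greedy action and spreads `δ_t` uniformly over the other
actions, with `δ_t → 0` almost surely. In a state with a single action that action has mass one. -/
def IsClippedMax [∀ s, Fintype (A s)] {Ω : Type*} {mΩ : MeasurableSpace Ω}
    (μ : Measure Ω) (q Q : ℕ → Ω → (s : S) → A s → ℝ) : Prop :=
  ∃ δ : ℕ → Ω → ℝ, ∀ᵐ ω ∂μ, Tendsto (fun t => δ t ω) atTop (𝓝 0) ∧
    ∀ t s, ∃ a, IsGreedy (Q t ω s) a ∧
      (q t ω s a = if Fintype.card (A s) = 1 then 1 else 1 - δ t ω) ∧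
      ∀ b, b ≠ a → q t ω s b = δ t ω / ((Fintype.card (A s) : ℝ) - 1)

end

/-! The proof separates probability from a pathwise argument. Along one trajectory the error `Δ = Q
- Q_*` satisfies `Δ' = (1 - a) Δ + a (g + w)`, with `a` the applied step, `g` the expected smoothed
Bellman error and `w` the sampling noise. The maximum is nonexpansive and the smoothed value differs
from it by a vanishing amount, so `|g| ≤ γ sup |Δ| + ε_t` with `ε_t → 0`.

If the series `∑ a w` converges, subtracting its remainder from `Δ` turns the noise into a vanishing
perturbation. As `∑ a = ∞`, an eventual bound `d` on `|Δ|` then improves to `γ d + η`; iterating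
from an a priori bound gives `Δ → 0` (`tendsto_zero_of_asynchronous_contraction`).

The series converges almost surely because it is built from martingales that become bounded in L²
after truncation (`ae_exists_tendsto_sum_mul_of_summable_sq`). The table `Q_t` is bounded only by a
random constant, since `Q_0` is arbitrary; its values are therefore moved into the predictable
coefficients, which leaves bounded noise. -/

/-! ### Pathwise stochastic approximation -/

/-- Since `1 - a ≤ exp (-a)`, the excess over `c` is damped by the exponential of minus the
accumulated step sizes, so the initial value is forgotten. -/
theorem eventually_abs_le_of_relaxation {u a h : ℕ → ℝ} {c η : ℝ}
    (ha : ∀ t, a t ∈ Set.Icc (0 : ℝ) 1)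
    (hsum : Tendsto (fun n => ∑ t ∈ Finset.range n, a t) atTop atTop)
    (hu : ∀ t, u (t + 1) = (1 - a t) * u t + a t * h t)
    (hh : ∀ᶠ t in atTop, |h t| ≤ c) (hη : 0 < η) :
    ∀ᶠ t in atTop, |u t| ≤ c + η := by
  obtain ⟨T, hT⟩ := eventually_atTop.1 hh
  have hc : 0 ≤ c := (abs_nonneg _).trans (hT T le_rfl)
  set σ : ℕ → ℝ := fun n => ∑ t ∈ Finset.range n, a t with hσ
  have key : ∀ n, T ≤ n → |u n| ≤ c + |u T| * Real.exp (-(σ n - σ T)) := by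
    intro n hn
    induction n, hn using Nat.le_induction with
    | base => simpa using hc
    | succ n hn ih =>
      obtain ⟨h0, h1⟩ := ha n
      have h1' : 0 ≤ 1 - a n := by linarith
      have hexp : 1 - a n ≤ Real.exp (-a n) := by
        have := Real.add_one_le_exp (-a n)
        linarith
      have e : Real.exp (-(σ (n + 1) - σ T))
          = Real.exp (-a n) * Real.exp (-(σ n - σ T)) := by
        rw [← Real.exp_add]
        congr 1
        simp only [hσ, Finset.sum_range_succ]
        ring
      calc |u (n + 1)| ≤ |(1 - a n) * u n| + |a n * h n| := by
            rw [hu]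
            exact abs_add_le _ _
        _ = (1 - a n) * |u n| + a n * |h n| := by
            rw [abs_mul, abs_mul, abs_of_nonneg h1', abs_of_nonneg h0]
        _ ≤ (1 - a n) * (c + |u T| * Real.exp (-(σ n - σ T))) + a n * c := by
            gcongr
            exact hT n hn
        _ = c + |u T| * ((1 - a n) * Real.exp (-(σ n - σ T))) := by ring
        _ ≤ c + |u T| * Real.exp (-(σ (n + 1) - σ T)) := by
            rw [e]
            gcongr
  have hlim : Tendsto (fun n => |u T| * Real.exp (-(σ n - σ T))) atTop (𝓝 0) := by
    have h1 : Tendsto (fun n => -(σ n - σ T)) atTop atBot :=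
      tendsto_neg_atTop_atBot.comp (tendsto_atTop_add_const_right _ (-σ T) hsum)
    simpa using (Real.tendsto_exp_atBot.comp h1).const_mul (|u T|)
  filter_upwards [hlim.eventually_le_const hη, eventually_ge_atTop T] with n h1 h2
  linarith [key n h2]

theorem tendsto_zero_of_asynchronous_contraction {X : Type*} [Finite X] {Δ a g w : ℕ → X → ℝ}
    {ε : ℕ → ℝ} {γ B : ℝ} (hγ0 : 0 ≤ γ) (hγ1 : γ < 1) (hε : Tendsto ε atTop (𝓝 0))
    (hB : ∀ t x, |Δ t x| ≤ B)
    (hrec : ∀ t x, Δ (t + 1) x = (1 - a t x) * Δ t x + a t x * (g t x + w t x))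
    (ha : ∀ t x, a t x ∈ Set.Icc (0 : ℝ) 1)
    (hsum : ∀ x, Tendsto (fun n => ∑ t ∈ Finset.range n, a t x) atTop atTop)
    (hw : ∀ x, ∃ L, Tendsto (fun n => ∑ t ∈ Finset.range n, a t x * w t x) atTop (𝓝 L))
    (hg : ∀ t x d, (∀ y, |Δ t y| ≤ d) → |g t x| ≤ γ * d + ε t) (x : X) :
    Tendsto (fun t => Δ t x) atTop (𝓝 0) := by
  choose L hL using hw
  have step : ∀ d η : ℝ, 0 < η → (∀ᶠ t in atTop, ∀ x, |Δ t x| ≤ d) →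
      ∀ᶠ t in atTop, ∀ x, |Δ t x| ≤ γ * d + η := by
    intro d η hη hd
    refine eventually_all.2 fun x => ?_
    -- Minus the tail of the noise series. The difference `Δ - m` obeys the same relaxation with
    -- target `g - m`, free of `w`.
    set m : ℕ → ℝ := fun n => (∑ t ∈ Finset.range n, a t x * w t x) - L x with hm
    have hm0 : Tendsto (fun n => |m n|) atTop (𝓝 0) := by
      simpa [hm] using ((hL x).sub_const (L x)).abs
    have hη4 : 0 < η / 4 := by positivity
    -- Budget for `η`: a quarter each for `ε`, for `m` inside the target, for the relaxation, and
    -- for returning from `Δ - m` to `Δ`.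
    have hev := eventually_abs_le_of_relaxation (u := fun n => Δ n x - m n) (a := fun t => a t x)
      (h := fun t => g t x - m t) (c := γ * d + η / 2) (η := η / 4) (fun t => ha t x) (hsum x)
      (fun t => by
        simp only [hrec, hm, Finset.sum_range_succ]
        ring)
      (by
        filter_upwards [hd, hε.eventually_le_const hη4, hm0.eventually_le_const hη4]
          with t h1 h2 h3
        have h4 := hg t x d h1
        have h5 := abs_sub (g t x) (m t)
        linarith) hη4
    filter_upwards [hev, hm0.eventually_le_const hη4] with t h1 h2
    have h3 := abs_sub_abs_le_abs_sub (Δ t x) (m t)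
    linarith
  have hB0 : 0 ≤ B := (abs_nonneg _).trans (hB 0 x)
  have iter : ∀ k : ℕ, ∀ η : ℝ, 0 < η → ∀ᶠ t in atTop, ∀ x, |Δ t x| ≤ γ ^ k * B + η := by
    intro k
    induction k with
    | zero =>
      intro η hη
      refine Eventually.of_forall fun t x => ?_
      have := hB t x
      simp only [pow_zero, one_mul]
      linarith
    | succ k ih =>
      intro η hη
      have hη2 : 0 < η / 2 := by positivity
      filter_upwards [step _ _ hη2 (ih _ hη2)] with t ht x
      have := ht x
      have h2 : γ * (η / 2) ≤ η / 2 := by nlinarith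
      calc |Δ t x| ≤ _ := this
        _ ≤ _ := by
          rw [pow_succ]
          nlinarith
  rw [Metric.tendsto_nhds]
  intro η hη
  have hpow : Tendsto (fun k : ℕ => γ ^ k * B) atTop (𝓝 0) := by
    simpa using (tendsto_pow_atTop_nhds_zero_of_lt_one hγ0 hγ1).mul_const B
  obtain ⟨k, hk⟩ := (hpow.eventually_lt_const (half_pos hη)).exists
  filter_upwards [iter k (η / 2) (half_pos hη)] with t ht
  rw [Real.dist_eq, sub_zero]
  linarith [ht x]

/-! ### Almost sure convergence of martingale series -/

/-- The increments are orthogonal, so the partial sums have second moment at most `C² K`. As `|x| ≤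
1 + x²`, they are bounded in L¹ and the martingale convergence theorem applies. -/
theorem ae_exists_tendsto_sum_mul_of_sum_sq_le {Ω : Type*} {mΩ : MeasurableSpace Ω}
    {μ : Measure Ω} [IsProbabilityMeasure μ] {ℱ : Filtration ℕ mΩ} {c ξ : ℕ → Ω → ℝ} {C K : ℝ}
    (hc : ∀ t, Measurable[ℱ t] (c t)) (hξ : ∀ t, Measurable[ℱ (t + 1)] (ξ t))
    (hξC : ∀ t, ∀ᵐ ω ∂μ, |ξ t ω| ≤ C) (hξ0 : ∀ t, μ[ξ t | ℱ t] =ᵐ[μ] 0)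
    (hcK : ∀ n ω, ∑ t ∈ Finset.range n, c t ω ^ 2 ≤ K) :
    ∀ᵐ ω ∂μ, ∃ l, Tendsto (fun n => ∑ t ∈ Finset.range n, c t ω * ξ t ω) atTop (𝓝 l) := by
  have hK : 0 ≤ K := by simpa using hcK 0 (Classical.choice μ.nonempty_of_neZero)
  have hC : 0 ≤ C := by
    obtain ⟨ω, hω⟩ := (hξC 0).exists
    exact (abs_nonneg _).trans hω
  have hcsq : ∀ t ω, c t ω ^ 2 ≤ K := fun t ω =>
    (Finset.single_le_sum (f := fun t => c t ω ^ 2) (fun _ _ => sq_nonneg _)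
      (Finset.self_mem_range_succ t)).trans (hcK (t + 1) ω)
  have hcabs : ∀ t ω, |c t ω| ≤ 1 + K := fun t ω => by
    have := hcsq t ω
    rw [← sq_abs] at this
    nlinarith [sq_nonneg (|c t ω| - 1)]
  have hξm : ∀ t, Measurable (ξ t) := fun t => (hξ t).mono (ℱ.le _) le_rfl
  have hcm : ∀ t, Measurable (c t) := fun t => (hc t).mono (ℱ.le _) le_rfl
  have hξi : ∀ t, Integrable (ξ t) μ := fun t =>
    .of_bound (hξm t).aestronglyMeasurable C (hξC t)
  set N : ℕ → Ω → ℝ := fun n ω => ∑ t ∈ Finset.range n, c t ω * ξ t ω with hN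
  have hNF : ∀ n, Measurable[ℱ n] (N n) := fun n =>
    Finset.measurable_fun_sum _ fun t ht =>
      ((hc t).mono (ℱ.mono (Finset.mem_range.1 ht).le) le_rfl).mul
        ((hξ t).mono (ℱ.mono (Finset.mem_range.1 ht)) le_rfl)
  have hNm : ∀ n, Measurable (N n) := fun n => (hNF n).mono (ℱ.le _) le_rfl
  have hinc : ∀ t, ∀ᵐ ω ∂μ, |c t ω * ξ t ω| ≤ (1 + K) * C := fun t => by
    filter_upwards [hξC t] with ω hω
    rw [abs_mul]
    exact mul_le_mul (hcabs t ω) hω (abs_nonneg _) (by positivity)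
  have hNb : ∀ n, ∀ᵐ ω ∂μ, |N n ω| ≤ n * ((1 + K) * C) := fun n => by
    filter_upwards [ae_all_iff.2 hinc] with ω hω
    calc |N n ω| ≤ ∑ t ∈ Finset.range n, |c t ω * ξ t ω| := Finset.abs_sum_le_sum_abs _ _
      _ ≤ ∑ _t ∈ Finset.range n, (1 + K) * C := Finset.sum_le_sum fun t _ => hω t
      _ = _ := by simp
  have hNi : ∀ n, Integrable (N n) μ := fun n =>
    .of_bound (hNm n).aestronglyMeasurable _ (hNb n)
  have hzero : ∀ n (f : Ω → ℝ) (b : ℝ), Measurable[ℱ n] f → (∀ᵐ ω ∂μ, |f ω| ≤ b) →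
      μ[f * ξ n | ℱ n] =ᵐ[μ] 0 := fun n f b hf hb => by
    filter_upwards [condExp_stronglyMeasurable_mul_of_bound (ℱ.le n) hf.stronglyMeasurable
      (hξi n) b hb, hξ0 n] with ω h1 h2
    simp [h1, h2]
  have hmart : Martingale N ℱ μ := by
    refine martingale_of_condExp_sub_eq_zero_nat (fun n => (hNF n).stronglyMeasurable) hNi
      fun n => ?_
    have : N (n + 1) - N n = c n * ξ n := by
      ext ω
      simp [hN, Finset.sum_range_succ]
    rw [this]
    exact hzero n (c n) (1 + K) (hc n) (.of_forall (hcabs n))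
  have hsqi : ∀ n, Integrable (fun ω => N n ω ^ 2) μ := fun n => by
    refine .of_bound ((hNm n).pow_const 2).aestronglyMeasurable ((n * ((1 + K) * C)) ^ 2) ?_
    filter_upwards [hNb n] with ω hω
    rw [Real.norm_eq_abs, abs_pow]
    gcongr
  have hSi : ∀ n, Integrable (fun ω => ∑ t ∈ Finset.range n, c t ω ^ 2) μ := fun n =>
    integrable_finsetSum _ fun t _ => .of_bound ((hcm t).pow_const 2).aestronglyMeasurable K
      (.of_forall fun ω => by
        rw [Real.norm_eq_abs, abs_of_nonneg (sq_nonneg _)]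
        exact hcsq t ω)
  have hci : ∀ n, Integrable (fun ω => c n ω ^ 2) μ := fun n =>
    .of_bound ((hcm n).pow_const 2).aestronglyMeasurable K
      (.of_forall fun ω => by
        rw [Real.norm_eq_abs, abs_of_nonneg (sq_nonneg _)]
        exact hcsq n ω)
  have hsq : ∀ n, ∫ ω, N n ω ^ 2 ∂μ ≤ C ^ 2 * ∫ ω, ∑ t ∈ Finset.range n, c t ω ^ 2 ∂μ := by
    intro n
    induction n with
    | zero => simp [hN]
    | succ n ih =>
      have hbd : ∀ᵐ ω ∂μ, |(N n * c n) ω| ≤ n * ((1 + K) * C) * (1 + K) := by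
        filter_upwards [hNb n] with ω hω
        rw [Pi.mul_apply, abs_mul]
        exact mul_le_mul hω (hcabs n ω) (abs_nonneg _) (by positivity)
      -- `N n * c n` is bounded and known at time `n`, while `ξ n` has zero conditional mean.
      have hcross : ∫ ω, N n ω * c n ω * ξ n ω ∂μ = 0 := by
        have h1 := hzero n (N n * c n) _ ((hNF n).mul (hc n)) hbd
        have h2 := integral_condExp (μ := μ) (f := N n * c n * ξ n) (ℱ.le n)
        rw [integral_congr_ae h1] at h2
        simpa using h2.symm
      have hcrossi : Integrable (fun ω => N n ω * c n ω * ξ n ω) μ :=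
        (hξi n).bdd_mul ((hNm n).mul (hcm n)).aestronglyMeasurable hbd
      have hle : ∀ᵐ ω ∂μ, N (n + 1) ω ^ 2 ≤
          N n ω ^ 2 + 2 * (N n ω * c n ω * ξ n ω) + C ^ 2 * c n ω ^ 2 := by
        filter_upwards [hξC n] with ω hω
        have e : N (n + 1) ω = N n ω + c n ω * ξ n ω := by simp [hN, Finset.sum_range_succ]
        have h2 : ξ n ω ^ 2 ≤ C ^ 2 := sq_le_sq' (neg_le_of_abs_le hω) (le_of_abs_le hω)
        rw [e]
        nlinarith [mul_le_mul_of_nonneg_left h2 (sq_nonneg (c n ω))]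
      calc ∫ ω, N (n + 1) ω ^ 2 ∂μ
          ≤ ∫ ω, (N n ω ^ 2 + 2 * (N n ω * c n ω * ξ n ω) + C ^ 2 * c n ω ^ 2) ∂μ :=
            integral_mono_ae (hsqi _)
              (((hsqi n).add (hcrossi.const_mul 2)).add ((hci n).const_mul _)) hle
        _ = ∫ ω, N n ω ^ 2 ∂μ + C ^ 2 * ∫ ω, c n ω ^ 2 ∂μ := by
            have hadd : Integrable (fun ω => N n ω ^ 2 + 2 * (N n ω * c n ω * ξ n ω)) μ :=
              (hsqi n).add (hcrossi.const_mul 2)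
            rw [integral_add hadd ((hci n).const_mul _),
              integral_add (hsqi n) (hcrossi.const_mul 2), integral_const_mul,
              integral_const_mul, hcross]
            simp
        _ ≤ _ := by
            simp only [Finset.sum_range_succ]
            rw [integral_add (hSi n) (hci n), mul_add]
            gcongr
  have hL1 : ∀ n, eLpNorm (N n) 1 μ ≤ ((1 + C ^ 2 * K).toNNReal : NNReal) := fun n => by
    rw [eLpNorm_one_eq_lintegral_enorm, ← ofReal_integral_norm_eq_lintegral_enorm (hNi n)]
    refine ENNReal.ofReal_le_ofReal ?_
    calc ∫ ω, ‖N n ω‖ ∂μ ≤ ∫ ω, (1 + N n ω ^ 2) ∂μ := by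
          refine integral_mono (hNi n).norm ((integrable_const _).add (hsqi n)) fun ω => ?_
          simp only [Real.norm_eq_abs]
          rw [← sq_abs]
          nlinarith [sq_nonneg (|N n ω| - 1)]
      _ = 1 + ∫ ω, N n ω ^ 2 ∂μ := by
          rw [integral_add (integrable_const _) (hsqi n)]
          simp
      _ ≤ 1 + C ^ 2 * ∫ ω, ∑ t ∈ Finset.range n, c t ω ^ 2 ∂μ := by
          gcongr
          exact hsq n
      _ ≤ 1 + C ^ 2 * ∫ _, K ∂μ := by
          have := mul_le_mul_of_nonneg_left
            (integral_mono (hSi n) (integrable_const K) fun ω => hcK n ω) (sq_nonneg C)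
          linarith
      _ = _ := by simp
  exact hmart.submartingale.exists_ae_tendsto_of_bdd hL1

theorem ae_exists_tendsto_sum_mul_of_summable_sq {Ω : Type*} {mΩ : MeasurableSpace Ω}
    {μ : Measure Ω} [IsProbabilityMeasure μ] {ℱ : Filtration ℕ mΩ} {c ξ : ℕ → Ω → ℝ} {C : ℝ}
    (hc : ∀ t, Measurable[ℱ t] (c t)) (hξ : ∀ t, Measurable[ℱ (t + 1)] (ξ t))
    (hξC : ∀ t, ∀ᵐ ω ∂μ, |ξ t ω| ≤ C) (hξ0 : ∀ t, μ[ξ t | ℱ t] =ᵐ[μ] 0)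
    (hsum : ∀ᵐ ω ∂μ, Summable fun t => c t ω ^ 2) :
    ∀ᵐ ω ∂μ, ∃ l, Tendsto (fun n => ∑ t ∈ Finset.range n, c t ω * ξ t ω) atTop (𝓝 l) := by
  classical
  set S : ℕ → Ω → ℝ := fun n ω => ∑ t ∈ Finset.range n, c t ω ^ 2 with hS
  -- The test uses `S (t + 1)`, which includes `c t`: it is still known at time `t`, and the
  -- truncated sum of squares cannot overshoot `K`.
  let d : ℕ → ℕ → Ω → ℝ := fun K t ω => if S (t + 1) ω ≤ K then c t ω else 0
  have hd : ∀ K t, Measurable[ℱ t] (d K t) := fun K t => by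
    have hSm : Measurable[ℱ t] (S (t + 1)) :=
      Finset.measurable_fun_sum _ fun i hi =>
        ((hc i).mono (ℱ.mono (Finset.mem_range_succ_iff.1 hi)) le_rfl).pow_const 2
    exact Measurable.ite (hSm measurableSet_Iic) (hc t) measurable_const
  have hdK : ∀ (K n : ℕ) ω, ∑ t ∈ Finset.range n, d K t ω ^ 2 ≤ K := by
    intro K n ω
    induction n with
    | zero => simp
    | succ n ih =>
      by_cases h : S (n + 1) ω ≤ K
      · refine (Finset.sum_le_sum fun t _ => ?_).trans h
        by_cases h' : S (t + 1) ω ≤ K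
        · simp [d, h']
        · simpa [d, h'] using sq_nonneg (c t ω)
      · rw [Finset.sum_range_succ]
        simpa [d, h] using ih
  have hall := ae_all_iff.2 fun K : ℕ =>
    ae_exists_tendsto_sum_mul_of_sum_sq_le (hd K) hξ hξC hξ0 (hdK K)
  filter_upwards [hall, hsum] with ω h1 h2
  -- For `K` above the full sum of squares, the truncation never acts on this path.
  obtain ⟨K, hK⟩ := exists_nat_ge (∑' t, c t ω ^ 2)
  obtain ⟨l, hl⟩ := h1 K
  refine ⟨l, hl.congr fun n => Finset.sum_congr rfl fun t _ => ?_⟩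
  have : S (t + 1) ω ≤ K := (h2.sum_le_tsum _ fun _ _ => sq_nonneg _).trans hK
  simp [d, this]

/-! ### The sampling law and conditional expectations -/

theorem measurable_eval_of_measurableSet_fiber {Ω I : Type*} [Finite I] {m : MeasurableSpace Ω}
    {W : Ω → I} (hW : ∀ i, MeasurableSet {ω | W ω = i}) {h : I → Ω → ℝ}
    (hh : ∀ i, Measurable (h i)) : Measurable fun ω => h (W ω) ω := by
  classical
  have := Fintype.ofFinite I
  have e : (fun ω => h (W ω) ω) = fun ω => ∑ i, if W ω = i then h i ω else 0 := by
    ext ω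
    simp
  rw [e]
  exact Finset.measurable_fun_sum _ fun i _ => Measurable.ite (hW i) (hh i) measurable_const

theorem setIntegral_eq_sum_fiber {Ω I : Type*} [Fintype I] {m : MeasurableSpace Ω}
    {μ : Measure Ω} {W : Ω → I} (hW : ∀ i, MeasurableSet {ω | W ω = i}) {f : Ω → ℝ}
    (hf : Integrable f μ) (G : Set Ω) :
    ∫ ω in G, f ω ∂μ = ∑ i, ∫ ω in G ∩ {ω | W ω = i}, f ω ∂μ := by
  classical
  have e : f = fun ω => ∑ i, {ω | W ω = i}.indicator f ω := by
    ext ω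
    simp [Set.indicator_apply]
  calc ∫ ω in G, f ω ∂μ = ∫ ω in G, ∑ i, {ω | W ω = i}.indicator f ω ∂μ := by rw [← e]
    _ = ∑ i, ∫ ω in G, {ω | W ω = i}.indicator f ω ∂μ :=
        integral_finsetSum _ fun i _ => (hf.indicator (hW i)).restrict
    _ = _ := Finset.sum_congr rfl fun i _ => setIntegral_indicator (hW i)

section

variable {S : Type*} [Fintype S] {A : S → Type*} {M : FiniteMDP S A} {Ω : Type*}
  {mΩ : MeasurableSpace Ω} {μ : Measure Ω} {ℱ : Filtration ℕ mΩ} {Z : ℕ → Ω → (Σ s, A s)}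
  {Y : ℕ → Ω → S} {r : ℕ → Ω → ℝ}

/-- This turns the conditional law into an identity of measures on each cell, from which almost sure
bounds and integrals of functions of the reward can be read off. -/
theorem FiniteMDP.IsSampling.map_reward_restrict [IsProbabilityMeasure μ]
    (h : M.IsSampling μ ℱ Z Y r) (t : ℕ) (z : Σ s, A s) (s' : S) {G : Set Ω}
    (hG : MeasurableSet[ℱ t] G) :
    (μ.restrict (G ∩ {ω | Z t ω = z} ∩ {ω | Y t ω = s'})).map (r t) =
      ENNReal.ofReal (M.p z.1 z.2 s' * μ.real (G ∩ {ω | Z t ω = z})) • M.ρ z.1 z.2 s' := by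
  have := M.ρ_prob z.1 z.2 s'
  have hr : Measurable (r t) := (h.measurable_reward t).mono (ℱ.le _) le_rfl
  have hY : MeasurableSet {ω | Y t ω = s'} := ℱ.le _ _ (h.measurable_next t s')
  have hH : MeasurableSet[ℱ t] (G ∩ {ω | Z t ω = z}) := hG.inter (h.measurable_pair t z)
  have hp : 0 ≤ M.p z.1 z.2 s' := (M.p_mem z.1 z.2).1 s'
  ext B hB
  have hE : MeasurableSet {ω | Y t ω = s' ∧ r t ω ∈ B} := hY.inter (hr hB)
  rw [Measure.map_apply hr hB, Measure.restrict_apply (hr hB), Measure.smul_apply, smul_eq_mul,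
    ← ENNReal.toReal_eq_toReal_iff' (measure_ne_top _ _)
      (ENNReal.mul_ne_top ENNReal.ofReal_ne_top (measure_ne_top _ _)), ENNReal.toReal_mul,
    ENNReal.toReal_ofReal (by positivity)]
  -- The conditional probability is integrated over `G ∩ {Z t = z}`, where its formula is constant.
  have h1 := setIntegral_condExp (μ := μ) (ℱ.le t)
    (f := {ω | Y t ω = s' ∧ r t ω ∈ B}.indicator fun _ => (1 : ℝ))
    ((integrable_const _).indicator hE) hH
  rw [setIntegral_congr_ae (g := fun _ => M.p z.1 z.2 s' * (M.ρ z.1 z.2 s').real B)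
    (ℱ.le _ _ hH) (by
      filter_upwards [h.cond_law t s' B hB] with ω hω hωH
      have hz : Z t ω = z := hωH.2
      rw [hω, hz]), integral_indicator hE, setIntegral_const, Measure.restrict_restrict hE,
    setIntegral_const, smul_eq_mul, smul_eq_mul, mul_one] at h1
  have e : r t ⁻¹' B ∩ (G ∩ {ω | Z t ω = z} ∩ {ω | Y t ω = s'}) =
      {ω | Y t ω = s' ∧ r t ω ∈ B} ∩ (G ∩ {ω | Z t ω = z}) := by
    ext ω
    simp only [Set.mem_inter_iff, Set.mem_preimage, Set.mem_ofPred_eq]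
    tauto
  rw [e]
  simp only [measureReal_def] at h1 ⊢
  rw [← h1]
  ring

theorem FiniteMDP.IsSampling.ae_abs_reward_le [IsProbabilityMeasure μ] [∀ s, Finite (A s)]
    (h : M.IsSampling μ ℱ Z Y r) {R : ℝ} (hR : ∀ s a s', ∀ᵐ x ∂(M.ρ s a s'), |x| ≤ R) (t : ℕ) :
    ∀ᵐ ω ∂μ, |r t ω| ≤ R := by
  have hr : Measurable (r t) := (h.measurable_reward t).mono (ℱ.le _) le_rfl
  have key : ∀ z s', ∀ᵐ ω ∂μ, Z t ω = z → Y t ω = s' → |r t ω| ≤ R := fun z s' => by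
    have hm : MeasurableSet (Set.univ ∩ {ω | Z t ω = z} ∩ {ω | Y t ω = s'}) :=
      (MeasurableSet.univ.inter (ℱ.le _ _ (h.measurable_pair t z))).inter
        (ℱ.le _ _ (h.measurable_next t s'))
    have h1 : ∀ᵐ x ∂((μ.restrict (Set.univ ∩ {ω | Z t ω = z} ∩ {ω | Y t ω = s'})).map (r t)),
        |x| ≤ R := by
      rw [h.map_reward_restrict t z s' MeasurableSet.univ]
      exact Measure.ae_smul_measure (hR _ _ _) _
    have h2 := (ae_restrict_iff' hm).1 (ae_of_ae_map hr.aemeasurable h1)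
    filter_upwards [h2] with ω hω hz hy using hω ⟨⟨trivial, hz⟩, hy⟩
  filter_upwards [ae_all_iff.2 fun z => ae_all_iff.2 (key z)] with ω hω using hω _ _ rfl rfl

theorem FiniteMDP.IsSampling.condExp_comp [IsProbabilityMeasure μ] [∀ s, Fintype (A s)]
    (h : M.IsSampling μ ℱ Z Y r) (t : ℕ) {f : S → ℝ → ℝ} (hf : ∀ s', Measurable (f s'))
    (hfi : Integrable (fun ω => f (Y t ω) (r t ω)) μ) :
    μ[fun ω => f (Y t ω) (r t ω) | ℱ t] =ᵐ[μ] fun ω =>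
      ∑ s', M.p (Z t ω).1 (Z t ω).2 s' * ∫ x, f s' x ∂(M.ρ (Z t ω).1 (Z t ω).2 s') := by
  set m : (Σ s, A s) → ℝ := fun z => ∑ s', M.p z.1 z.2 s' * ∫ x, f s' x ∂(M.ρ z.1 z.2 s')
    with hm
  have hr : Measurable (r t) := (h.measurable_reward t).mono (ℱ.le _) le_rfl
  have hZ : ∀ z, MeasurableSet {ω | Z t ω = z} := fun z => ℱ.le _ _ (h.measurable_pair t z)
  have hY : ∀ s', MeasurableSet {ω | Y t ω = s'} := fun s' => ℱ.le _ _ (h.measurable_next t s')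
  have hmF : Measurable[ℱ t] fun ω => m (Z t ω) :=
    measurable_eval_of_measurableSet_fiber (m := ℱ t) (h.measurable_pair t) (h := fun z _ => m z)
      fun _ => measurable_const
  have hmi : Integrable (fun ω => m (Z t ω)) μ := by
    refine .of_bound (hmF.mono (ℱ.le _) le_rfl).aestronglyMeasurable (∑ z, |m z|)
      (.of_forall fun ω => ?_)
    exact Finset.single_le_sum (f := fun z => |m z|) (fun _ _ => abs_nonneg _)
      (Finset.mem_univ (Z t ω))
  symm
  refine ae_eq_condExp_of_forall_setIntegral_eq (ℱ.le t) hfi (fun _ _ _ => hmi.integrableOn) ?_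
    hmF.stronglyMeasurable.aestronglyMeasurable
  intro G hG _
  rw [setIntegral_eq_sum_fiber hZ hmi, setIntegral_eq_sum_fiber hZ hfi]
  refine Finset.sum_congr rfl fun z _ => ?_
  have hH : MeasurableSet (G ∩ {ω | Z t ω = z}) := (ℱ.le _ _ hG).inter (hZ z)
  rw [setIntegral_eq_sum_fiber hY hfi,
    setIntegral_congr_fun (g := fun _ => m z) hH fun ω hω => congrArg m hω.2,
    setIntegral_const, smul_eq_mul, hm, Finset.mul_sum]
  refine Finset.sum_congr rfl fun s' _ => ?_
  rw [setIntegral_congr_fun (g := fun ω => f s' (r t ω)) (hH.inter (hY s'))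
      fun ω hω => by rw [show Y t ω = s' from hω.2],
    ← integral_map (φ := r t) (f := f s') hr.aemeasurable (hf s').aestronglyMeasurable,
    h.map_reward_restrict t z s' hG, integral_smul_measure, ENNReal.toReal_ofReal
      (mul_nonneg ((M.p_mem z.1 z.2).1 s') measureReal_nonneg), smul_eq_mul]
  ring

end

/-! ### Averages against maxima over finitely many actions -/

theorem abs_ciSup_sub_ciSup_le {B : Type*} [Finite B] [Nonempty B] {v w : B → ℝ} {d : ℝ}
    (h : ∀ b, |v b - w b| ≤ d) : |(⨆ b, v b) - ⨆ b, w b| ≤ d := by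
  have hv := (Set.finite_range v).bddAbove
  have hw := (Set.finite_range w).bddAbove
  rw [abs_sub_le_iff]
  constructor
  · rw [sub_le_iff_le_add]
    exact ciSup_le fun b => by linarith [le_ciSup hw b, le_of_abs_le (h b)]
  · rw [sub_le_iff_le_add]
    exact ciSup_le fun b => by linarith [le_ciSup hv b, neg_le_of_abs_le (h b)]

theorem abs_sum_mul_le_of_mem_stdSimplex {B : Type*} [Fintype B] {w v : B → ℝ} {d : ℝ}
    (hw : w ∈ stdSimplex ℝ B) (hv : ∀ b, |v b| ≤ d) : |∑ b, w b * v b| ≤ d :=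
  calc |∑ b, w b * v b| ≤ ∑ b, |w b * v b| := Finset.abs_sum_le_sum_abs _ _
    _ ≤ ∑ b, w b * d := Finset.sum_le_sum fun b _ => by
        rw [abs_mul, abs_of_nonneg (hw.1 b)]
        exact mul_le_mul_of_nonneg_left (hv b) (hw.1 b)
    _ = d := by rw [← Finset.sum_mul, hw.2, one_mul]

theorem ciSup_sub_sum_mul_eq {B : Type*} [Fintype B] {w v : B → ℝ} (hw : w ∈ stdSimplex ℝ B) :
    (⨆ b, v b) - ∑ b, w b * v b = ∑ b, w b * ((⨆ b, v b) - v b) := by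
  simp only [mul_sub, Finset.sum_sub_distrib, ← Finset.sum_mul, hw.2, one_mul]

theorem ciSup_sub_sum_mul_nonneg {B : Type*} [Fintype B] {w v : B → ℝ}
    (hw : w ∈ stdSimplex ℝ B) : 0 ≤ (⨆ b, v b) - ∑ b, w b * v b := by
  rw [ciSup_sub_sum_mul_eq hw]
  exact Finset.sum_nonneg fun b _ =>
    mul_nonneg (hw.1 b) (sub_nonneg.2 (le_ciSup (Set.finite_range v).bddAbove b))

-- Only non-greedy actions contribute to the gap; their mass is at most `δ` and each loses at most
-- `2 * d`.
open Classical in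
theorem ciSup_sub_sum_mul_le_of_concentrated {B : Type*} [Fintype B] [Nonempty B] {w v : B → ℝ}
    {δ d : ℝ} (hw : w ∈ stdSimplex ℝ B) (hv : ∀ b, |v b| ≤ d)
    (hδ : 1 - δ ≤ ∑ b with IsGreedy v b, w b) :
    (⨆ b, v b) - ∑ b, w b * v b ≤ δ * (2 * d) := by
  have hsup : (⨆ b, v b) ≤ d := ciSup_le fun b => le_of_abs_le (hv b)
  have hd : 0 ≤ d := (abs_nonneg _).trans (hv (Classical.arbitrary B))
  have hsplit := Finset.sum_filter_add_sum_filter_not Finset.univ (IsGreedy v) w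
  rw [hw.2] at hsplit
  calc (⨆ b, v b) - ∑ b, w b * v b = ∑ b, w b * ((⨆ b, v b) - v b) := ciSup_sub_sum_mul_eq hw
    _ ≤ ∑ b, (if ¬ IsGreedy v b then w b else 0) * (2 * d) := by
        refine Finset.sum_le_sum fun b _ => ?_
        by_cases hb : IsGreedy v b
        · have : (⨆ b, v b) ≤ v b := ciSup_le hb
          simpa [hb] using mul_nonpos_of_nonneg_of_nonpos (hw.1 b) (by linarith)
        · simp only [hb, not_false_eq_true, if_true]
          exact mul_le_mul_of_nonneg_left (by linarith [neg_le_of_abs_le (hv b)]) (hw.1 b)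
    _ = (∑ b with ¬ IsGreedy v b, w b) * (2 * d) := by
        rw [← Finset.sum_mul, Finset.sum_filter]
    _ ≤ δ * (2 * d) := mul_le_mul_of_nonneg_right (by linarith) (by linarith)

/-- The normalizer contains the maximizer's term, so an action with gap `x` has weight at most `exp
(-β x)`; and `β x exp (-β x) ≤ 1`. -/
theorem ciSup_sub_sum_mul_le_of_softmax {B : Type*} [Fintype B] [Nonempty B] {w v : B → ℝ}
    {β : ℝ} (hβ : 0 < β) (hw : w ∈ stdSimplex ℝ B)
    (h : ∀ b, w b = Real.exp (β * v b) / ∑ c, Real.exp (β * v c)) :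
    (⨆ b, v b) - ∑ b, w b * v b ≤ Fintype.card B / β := by
  obtain ⟨m, hm⟩ := exists_eq_ciSup_of_finite (f := v)
  rw [ciSup_sub_sum_mul_eq hw, ← hm]
  have hle : ∀ b, w b * (v m - v b) ≤ 1 / β := fun b => by
    have h0 : 0 ≤ v m - v b := by
      rw [hm]
      exact sub_nonneg.2 (le_ciSup (Set.finite_range v).bddAbove b)
    have h1 : w b ≤ Real.exp (-(β * (v m - v b))) := by
      rw [h b, show -(β * (v m - v b)) = β * v b - β * v m by ring, Real.exp_sub]
      gcongr
      exact Finset.single_le_sum (f := fun c => Real.exp (β * v c))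
        (fun _ _ => (Real.exp_pos _).le) (Finset.mem_univ m)
    have h2 : β * (v m - v b) ≤ Real.exp (β * (v m - v b)) := by
      linarith [Real.add_one_le_exp (β * (v m - v b))]
    rw [le_div_iff₀ hβ]
    calc w b * (v m - v b) * β = w b * (β * (v m - v b)) := by ring
      _ ≤ Real.exp (-(β * (v m - v b))) * Real.exp (β * (v m - v b)) := by gcongr
      _ = 1 := by rw [← Real.exp_add, neg_add_cancel, Real.exp_zero]
  calc ∑ b, w b * (v m - v b) ≤ ∑ _b : B, 1 / β := Finset.sum_le_sum fun b _ => hle b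
    _ = _ := by simp [div_eq_mul_inv]

/-! ### Vanishing smoothing error and the Bellman fixed point -/

section

variable {S : Type*} {A : S → Type*} [∀ s, Fintype (A s)] {Ω : Type*}
  {mΩ : MeasurableSpace Ω} {μ : Measure Ω} {q Q : ℕ → Ω → (s : S) → A s → ℝ}

theorem IsClippedMax.concentratesOnGreedy (hq_mem : ∀ t ω s, q t ω s ∈ stdSimplex ℝ (A s))
    (h : IsClippedMax μ q Q) : ConcentratesOnGreedy μ q Q := by
  classical
  obtain ⟨δ, hδ⟩ := h
  -- The absolute value covers single-action states, where the mass is one whatever the sign of `δ`.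
  refine ⟨fun t ω => |δ t ω|, ?_⟩
  filter_upwards [hδ] with ω ⟨h0, h1⟩
  refine ⟨by simpa using h0.abs, fun t s => ?_⟩
  obtain ⟨a, ha, hqa, -⟩ := h1 t s
  have hle : q t ω s a ≤ ∑ b with IsGreedy (Q t ω s) b, q t ω s b :=
    Finset.single_le_sum (f := fun b => q t ω s b) (fun b _ => (hq_mem t ω s).1 b)
      (by simpa using ha)
  have hge : 1 - |δ t ω| ≤ q t ω s a := by
    rw [hqa]
    split_ifs
    · linarith [abs_nonneg (δ t ω)]
    · linarith [le_abs_self (δ t ω)]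
  convert hge.trans hle

theorem ae_tendsto_smoothed_sub_max [∀ s, Nonempty (A s)]
    (hq_mem : ∀ t ω s, q t ω s ∈ stdSimplex ℝ (A s))
    (hq : ConcentratesOnGreedy μ q Q ∨ IsSharpeningSoftmax μ q Q ∨ IsClippedMax μ q Q)
    (hQ : ∀ᵐ ω ∂μ, ∃ B, ∀ t s a, |Q t ω s a| ≤ B) :
    ∀ᵐ ω ∂μ, ∀ s, Tendsto (fun t => (∑ b, q t ω s b * Q t ω s b) - ⨆ b, Q t ω s b)
      atTop (𝓝 0) := by
  have key : ∀ ω s (e : ℕ → ℝ), Tendsto e atTop (𝓝 0) →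
      (∀ᶠ t in atTop, (⨆ b, Q t ω s b) - ∑ b, q t ω s b * Q t ω s b ≤ e t) →
      Tendsto (fun t => (∑ b, q t ω s b * Q t ω s b) - ⨆ b, Q t ω s b) atTop (𝓝 0) := by
    intro ω s e he hle
    have := (tendsto_of_tendsto_of_tendsto_of_le_of_le' tendsto_const_nhds he
      (.of_forall fun t => ciSup_sub_sum_mul_nonneg (v := Q t ω s) (hq_mem t ω s)) hle).neg
    simpa using this
  have hconc : ConcentratesOnGreedy μ q Q → ∀ᵐ ω ∂μ, ∀ s,
      Tendsto (fun t => (∑ b, q t ω s b * Q t ω s b) - ⨆ b, Q t ω s b) atTop (𝓝 0) := by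
    rintro ⟨δ, hδ⟩
    filter_upwards [hδ, hQ] with ω ⟨h0, h1⟩ ⟨B, hB⟩ s
    refine key ω s (fun t => δ t ω * (2 * B)) (by simpa using h0.mul_const (2 * B))
      (.of_forall fun t => ?_)
    exact ciSup_sub_sum_mul_le_of_concentrated (hq_mem t ω s) (hB t s) (h1 t s)
  rcases hq with hq | hq | hq
  · exact hconc hq
  · obtain ⟨β, hβ⟩ := hq
    filter_upwards [hβ] with ω ⟨h0, h1⟩ s
    refine key ω s (fun t => Fintype.card (A s) / β t ω) (h0.const_div_atTop _) ?_
    filter_upwards [h0.eventually_gt_atTop 0] with t ht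
    exact ciSup_sub_sum_mul_le_of_softmax ht (hq_mem t ω s) (h1 t s)
  · exact hconc (hq.concentratesOnGreedy hq_mem)

/-- The Bellman operator is a `γ`-contraction in the sup norm, so Banach's fixed point theorem
applies. -/
theorem FiniteMDP.existsUnique_isOptimalQ [Fintype S] [∀ s, Nonempty (A s)] (M : FiniteMDP S A) :
    ∃! Qs : (s : S) → A s → ℝ, M.IsOptimalQ Qs := by
  let T : ((s : S) → A s → ℝ) → (s : S) → A s → ℝ := fun Q s a =>
    ∑ s', M.p s a s' * ((∫ x, x ∂(M.ρ s a s')) + M.γ * ⨆ b, Q s' b)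
  have hT : ContractingWith ⟨M.γ, M.γ_nonneg⟩ T := by
    refine ⟨M.γ_lt_one, LipschitzWith.of_dist_le_mul fun Q Q' => ?_⟩
    have h0 : 0 ≤ M.γ * dist Q Q' := mul_nonneg M.γ_nonneg dist_nonneg
    refine (dist_pi_le_iff h0).2 fun s => (dist_pi_le_iff h0).2 fun a => ?_
    have e : T Q s a - T Q' s a =
        ∑ s', M.p s a s' * (M.γ * ((⨆ b, Q s' b) - ⨆ b, Q' s' b)) := by
      rw [← Finset.sum_sub_distrib]
      exact Finset.sum_congr rfl fun s' _ => by ring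
    rw [Real.dist_eq, e]
    refine abs_sum_mul_le_of_mem_stdSimplex (M.p_mem s a) fun s' => ?_
    rw [abs_mul, abs_of_nonneg M.γ_nonneg]
    refine mul_le_mul_of_nonneg_left (abs_ciSup_sub_ciSup_le fun b => ?_) M.γ_nonneg
    rw [← Real.dist_eq]
    exact (dist_le_pi_dist (Q s') (Q' s') b).trans (dist_le_pi_dist Q Q' s')
  refine ⟨ContractingWith.fixedPoint T hT, fun s a => ?_, fun Q' hQ' => ?_⟩
  · exact congrFun (congrFun (ContractingWith.fixedPoint_isFixedPt hT).symm s) a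
  · exact hT.fixedPoint_unique (funext fun s => funext fun a => (hQ' s a).symm)

end

/-! ### Smoothed Q-learning: boundedness, noise and convergence -/

section

variable {S : Type*} {A : S → Type*} {Ω : Type*} {Z : ℕ → Ω → (Σ s, A s)}
  {α q Q : ℕ → Ω → (s : S) → A s → ℝ}

theorem appliedStep_mem_Icc {t : ℕ} {ω : Ω} {s : S} {a : A s}
    (h : α t ω s a ∈ Set.Icc (0 : ℝ) 1) : appliedStep Z α t ω s a ∈ Set.Icc (0 : ℝ) 1 := by
  unfold appliedStep
  split_ifs
  · exact h
  · exact ⟨le_rfl, zero_le_one⟩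

variable [Fintype S] {mΩ : MeasurableSpace Ω} {μ : Measure Ω} {ℱ : Filtration ℕ mΩ}
  {Y : ℕ → Ω → S} {r : ℕ → Ω → ℝ} {M : FiniteMDP S A}

theorem FiniteMDP.IsSampling.measurable_appliedStep (h : M.IsSampling μ ℱ Z Y r)
    (hα : ∀ t s a, Measurable[ℱ t] fun ω => α t ω s a) (t : ℕ) (s : S) (a : A s) :
    Measurable[ℱ t] fun ω => appliedStep Z α t ω s a := by
  unfold appliedStep
  exact Measurable.ite (h.measurable_pair t ⟨s, a⟩) (hα t s a) measurable_const

variable [∀ s, Fintype (A s)]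

theorem IsSmoothedQLearning.measurable (hsample : M.IsSampling μ ℱ Z Y r)
    (hα : ∀ t s a, Measurable[ℱ t] fun ω => α t ω s a)
    (hq : ∀ t s a, Measurable[ℱ t] fun ω => q t ω s a)
    (hQ0 : ∀ s a, Measurable[ℱ 0] fun ω => Q 0 ω s a) {γ : ℝ}
    (hQ : IsSmoothedQLearning γ Z Y r α q Q) (t : ℕ) :
    ∀ s a, Measurable[ℱ t] fun ω => Q t ω s a := by
  induction t with
  | zero => exact hQ0
  | succ t ih =>
    intro s a
    have hle := ℱ.mono t.le_succ
    have hV : Measurable[ℱ (t + 1)] fun ω => ∑ b, q t ω (Y t ω) b * Q t ω (Y t ω) b :=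
      measurable_eval_of_measurableSet_fiber (m := ℱ (t + 1)) (hsample.measurable_next t)
        (h := fun s' ω => ∑ b, q t ω s' b * Q t ω s' b) fun s' =>
          (Finset.measurable_fun_sum _ fun b _ => (hq t s' b).mul (ih s' b)).mono hle le_rfl
    have e : (fun ω => Q (t + 1) ω s a) = fun ω => Q t ω s a + appliedStep Z α t ω s a *
        (r t ω + γ * (∑ b, q t ω (Y t ω) b * Q t ω (Y t ω) b) - Q t ω s a) :=
      funext fun ω => hQ t ω s a
    rw [e]
    have hQt : Measurable[ℱ (t + 1)] fun ω => Q t ω s a := (ih s a).mono hle le_rfl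
    exact hQt.add (((hsample.measurable_appliedStep hα t s a).mono hle le_rfl).mul
      (((hsample.measurable_reward t).add (hV.const_mul γ)).sub hQt))

theorem IsSmoothedQLearning.exists_bound {γ R : ℝ} (hγ0 : 0 ≤ γ) (hγ1 : γ < 1)
    (hQ : IsSmoothedQLearning γ Z Y r α q Q) (hq : ∀ t ω s, q t ω s ∈ stdSimplex ℝ (A s))
    {ω : Ω} (hα : ∀ t s a, α t ω s a ∈ Set.Icc (0 : ℝ) 1) (hr : ∀ t, |r t ω| ≤ R) :
    ∃ B, ∀ t s a, |Q t ω s a| ≤ B := by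
  have hγ : 0 < 1 - γ := sub_pos.2 hγ1
  have hR : 0 ≤ R := (abs_nonneg _).trans (hr 0)
  set B₀ : ℝ := ∑ x : Σ s, A s, |Q 0 ω x.1 x.2| with hB₀
  have hB₀_nonneg : 0 ≤ B₀ := Finset.sum_nonneg fun _ _ => abs_nonneg _
  -- Chosen to dominate the initial table and to satisfy `R + γ * B ≤ B`, so that updates preserve
  -- the bound.
  set B : ℝ := B₀ + R / (1 - γ) with hB
  have hRB : R + γ * B ≤ B := by
    have : (1 - γ) * (R / (1 - γ)) = R := mul_div_cancel₀ _ hγ.ne'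
    nlinarith [mul_nonneg hγ.le hB₀_nonneg]
  refine ⟨B, fun t => ?_⟩
  induction t with
  | zero =>
    intro s a
    have h1 : |Q 0 ω s a| ≤ B₀ :=
      Finset.single_le_sum (f := fun x : Σ s, A s => |Q 0 ω x.1 x.2|) (fun _ _ => abs_nonneg _)
        (Finset.mem_univ ⟨s, a⟩)
    have h2 : 0 ≤ R / (1 - γ) := by positivity
    linarith
  | succ t ih =>
    intro s a
    obtain ⟨h0, h1⟩ := appliedStep_mem_Icc (Z := Z) (hα t s a)
    set c := appliedStep Z α t ω s a
    set V := ∑ b, q t ω (Y t ω) b * Q t ω (Y t ω) b with hV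
    have hVB : |V| ≤ B := abs_sum_mul_le_of_mem_stdSimplex (hq t ω (Y t ω)) (ih (Y t ω))
    have h1' : 0 ≤ 1 - c := by linarith
    have hT : |r t ω + γ * V| ≤ B :=
      calc |r t ω + γ * V| ≤ |r t ω| + |γ * V| := abs_add_le _ _
        _ ≤ R + γ * B := by
          rw [abs_mul, abs_of_nonneg hγ0]
          gcongr
          exact hr t
        _ ≤ B := hRB
    calc |Q (t + 1) ω s a| = |(1 - c) * Q t ω s a + c * (r t ω + γ * V)| := by
          rw [hQ t ω s a]
          congr 1
          ring
      _ ≤ |(1 - c) * Q t ω s a| + |c * (r t ω + γ * V)| := abs_add_le _ _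
      _ ≤ (1 - c) * B + c * B := by
          rw [abs_mul, abs_mul, abs_of_nonneg h0, abs_of_nonneg h1']
          gcongr
          exact ih s a
      _ = B := by ring

theorem FiniteMDP.IsSampling.ae_exists_tendsto_sum_noise [IsProbabilityMeasure μ]
    (h : M.IsSampling μ ℱ Z Y r) {f : S → ℝ → ℝ} (hf : ∀ s', Measurable (f s')) {C : ℝ}
    (hfC : ∀ t, ∀ᵐ ω ∂μ, |f (Y t ω) (r t ω)| ≤ C) {c : ℕ → Ω → ℝ}
    (hc : ∀ t, Measurable[ℱ t] (c t)) (hsum : ∀ᵐ ω ∂μ, Summable fun t => c t ω ^ 2) :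
    ∀ᵐ ω ∂μ, ∃ l, Tendsto (fun n => ∑ t ∈ Finset.range n, c t ω * (f (Y t ω) (r t ω) -
      ∑ s', M.p (Z t ω).1 (Z t ω).2 s' * ∫ x, f s' x ∂(M.ρ (Z t ω).1 (Z t ω).2 s')))
      atTop (𝓝 l) := by
  set m : (Σ s, A s) → ℝ := fun z => ∑ s', M.p z.1 z.2 s' * ∫ x, f s' x ∂(M.ρ z.1 z.2 s')
    with hm
  have hmF : ∀ t, Measurable[ℱ t] fun ω => m (Z t ω) := fun t =>
    measurable_eval_of_measurableSet_fiber (m := ℱ t) (h.measurable_pair t) (h := fun z _ => m z)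
      fun _ => measurable_const
  have hmb : ∀ t ω, |m (Z t ω)| ≤ ∑ z, |m z| := fun t ω =>
    Finset.single_le_sum (f := fun z => |m z|) (fun _ _ => abs_nonneg _)
      (Finset.mem_univ (Z t ω))
  have hfF : ∀ t, Measurable[ℱ (t + 1)] fun ω => f (Y t ω) (r t ω) := fun t =>
    measurable_eval_of_measurableSet_fiber (m := ℱ (t + 1)) (h.measurable_next t)
      (h := fun s' ω => f s' (r t ω)) fun s' => (hf s').comp (h.measurable_reward t)
  have hfi : ∀ t, Integrable (fun ω => f (Y t ω) (r t ω)) μ := fun t =>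
    .of_bound ((hfF t).mono (ℱ.le _) le_rfl).aestronglyMeasurable C (hfC t)
  have hmi : ∀ t, Integrable (fun ω => m (Z t ω)) μ := fun t =>
    .of_bound ((hmF t).mono (ℱ.le _) le_rfl).aestronglyMeasurable _ (.of_forall (hmb t))
  refine ae_exists_tendsto_sum_mul_of_summable_sq (C := C + ∑ z, |m z|) hc
    (ξ := fun t ω => f (Y t ω) (r t ω) - m (Z t ω))
    (fun t => (hfF t).sub ((hmF t).mono (ℱ.mono t.le_succ) le_rfl)) (fun t => ?_) (fun t => ?_)
    hsum
  · filter_upwards [hfC t] with ω hω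
    exact (abs_sub _ _).trans (add_le_add hω (hmb t ω))
  · have h1 := condExp_sub (hfi t) (hmi t) (ℱ t)
    have h2 := condExp_of_stronglyMeasurable (ℱ.le t) (hmF t).stronglyMeasurable (hmi t)
    filter_upwards [h1, h.condExp_comp t hf (hfi t)] with ω e1 e2
    rw [h2, Pi.sub_apply, e2] at e1
    rw [Pi.zero_apply]
    exact e1.trans (sub_self _)

theorem IsSmoothedQLearning.tendsto_of_noise_summable [∀ s, Nonempty (A s)]
    (hQ : IsSmoothedQLearning M.γ Z Y r α q Q) {Qs : (s : S) → A s → ℝ}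
    (hQs : M.IsOptimalQ Qs) {ω : Ω} {B : ℝ} (hB : ∀ t s a, |Q t ω s a| ≤ B)
    (hα : ∀ t s a, α t ω s a ∈ Set.Icc (0 : ℝ) 1)
    (hsum : ∀ s a,
      Tendsto (fun n => ∑ t ∈ Finset.range n, appliedStep Z α t ω s a) atTop atTop)
    (hsm : ∀ s, Tendsto (fun t => (∑ b, q t ω s b * Q t ω s b) - ⨆ b, Q t ω s b) atTop (𝓝 0))
    (hw : ∀ s a, ∃ l, Tendsto (fun n => ∑ t ∈ Finset.range n, appliedStep Z α t ω s a *
      (r t ω + M.γ * (∑ b, q t ω (Y t ω) b * Q t ω (Y t ω) b) -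
        ∑ s', M.p (Z t ω).1 (Z t ω).2 s' * ((∫ x, x ∂(M.ρ (Z t ω).1 (Z t ω).2 s')) +
          M.γ * ∑ b, q t ω s' b * Q t ω s' b))) atTop (𝓝 l)) (s : S) (a : A s) :
    Tendsto (fun t => Q t ω s a) atTop (𝓝 (Qs s a)) := by
  set V : ℕ → S → ℝ := fun t s' => ∑ b, q t ω s' b * Q t ω s' b with hV
  have hε : Tendsto (fun t => M.γ * ∑ s, |V t s - ⨆ b, Q t ω s b|) atTop (𝓝 0) := by
    have := (tendsto_finsetSum Finset.univ fun s _ => (hsm s).abs).const_mul M.γ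
    simpa using this
  have hQsB : ∀ t (x : Σ s, A s),
      |Q t ω x.1 x.2 - Qs x.1 x.2| ≤ B + ∑ y : Σ s, A s, |Qs y.1 y.2| := fun t x =>
    (abs_sub _ _).trans (add_le_add (hB t x.1 x.2)
      (Finset.single_le_sum (f := fun y : Σ s, A s => |Qs y.1 y.2|) (fun _ _ => abs_nonneg _)
        (Finset.mem_univ x)))
  -- The noise `w` is that of the visited pair and is used for every entry; this is harmless because
  -- unvisited entries have step zero.
  have main := tendsto_zero_of_asynchronous_contraction (X := Σ s, A s)
    (Δ := fun t x => Q t ω x.1 x.2 - Qs x.1 x.2)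
    (a := fun t x => appliedStep Z α t ω x.1 x.2)
    (g := fun t x => ∑ s', M.p x.1 x.2 s' * (M.γ * (V t s' - ⨆ b, Qs s' b)))
    (w := fun t _ => r t ω + M.γ * V t (Y t ω) -
      ∑ s', M.p (Z t ω).1 (Z t ω).2 s' * ((∫ x, x ∂(M.ρ (Z t ω).1 (Z t ω).2 s')) +
        M.γ * V t s'))
    M.γ_nonneg M.γ_lt_one hε hQsB
    (by
      rintro t ⟨s, a⟩
      by_cases hz : Z t ω = ⟨s, a⟩
      · have e : ∑ s', M.p s a s' * (M.γ * (V t s' - ⨆ b, Qs s' b)) =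
            ∑ s', M.p s a s' * ((∫ x, x ∂(M.ρ s a s')) + M.γ * V t s') - Qs s a := by
          rw [hQs s a, ← Finset.sum_sub_distrib]
          exact Finset.sum_congr rfl fun s' _ => by ring
        have e' : ∑ s', M.p (Z t ω).1 (Z t ω).2 s' * ((∫ x, x ∂(M.ρ (Z t ω).1 (Z t ω).2 s')) +
            M.γ * V t s') = ∑ s', M.p s a s' * ((∫ x, x ∂(M.ρ s a s')) + M.γ * V t s') := by
          rw [hz]
        have hVY : ∑ b, q t ω (Y t ω) b * Q t ω (Y t ω) b = V t (Y t ω) := rfl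
        dsimp only
        rw [e, e', hQ t ω s a, hVY]
        ring
      · have e : appliedStep Z α t ω s a = 0 := by simp [appliedStep, hz]
        simp [hQ t ω s a, e])
    (fun t x => appliedStep_mem_Icc (hα t x.1 x.2)) (fun x => hsum x.1 x.2)
    (fun x => hw x.1 x.2)
    (by
      intro t x d hd
      refine abs_sum_mul_le_of_mem_stdSimplex (M.p_mem x.1 x.2) fun s' => ?_
      rw [abs_mul, abs_of_nonneg M.γ_nonneg, ← mul_add]
      refine mul_le_mul_of_nonneg_left ?_ M.γ_nonneg
      have h1 : |(⨆ b, Q t ω s' b) - ⨆ b, Qs s' b| ≤ d :=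
        abs_ciSup_sub_ciSup_le fun b => hd ⟨s', b⟩
      have h2 : |V t s' - ⨆ b, Q t ω s' b| ≤ ∑ s, |V t s - ⨆ b, Q t ω s b| :=
        Finset.single_le_sum (f := fun s => |V t s - ⨆ b, Q t ω s b|)
          (fun _ _ => abs_nonneg _) (Finset.mem_univ s')
      have h3 := abs_sub_le (V t s') (⨆ b, Q t ω s' b) (⨆ b, Qs s' b)
      linarith) ⟨s, a⟩
  simpa using main.add_const (Qs s a)

/-- The next-state value is `∑ s', V t s' * 1{Y t = s'}`. The noise thus splits into the reward part
and, for each `s'`, centred indicator noise with predictable coefficient `c * V`. -/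
theorem FiniteMDP.IsSampling.ae_exists_tendsto_sum_qLearning_noise [IsProbabilityMeasure μ]
    (hsample : M.IsSampling μ ℱ Z Y r)
    (hq_meas : ∀ t s a, Measurable[ℱ t] fun ω => q t ω s a)
    (hq_mem : ∀ t ω s, q t ω s ∈ stdSimplex ℝ (A s))
    (hQ_meas : ∀ t s a, Measurable[ℱ t] fun ω => Q t ω s a)
    (hQ_bdd : ∀ᵐ ω ∂μ, ∃ B, ∀ t s a, |Q t ω s a| ≤ B)
    {R : ℝ} (hr : ∀ t, ∀ᵐ ω ∂μ, |r t ω| ≤ R) {c : ℕ → Ω → ℝ}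
    (hc : ∀ t, Measurable[ℱ t] (c t)) (hsum : ∀ᵐ ω ∂μ, Summable fun t => c t ω ^ 2) :
    ∀ᵐ ω ∂μ, ∃ l, Tendsto (fun n => ∑ t ∈ Finset.range n, c t ω *
      (r t ω + M.γ * (∑ b, q t ω (Y t ω) b * Q t ω (Y t ω) b) -
        ∑ s', M.p (Z t ω).1 (Z t ω).2 s' * ((∫ x, x ∂(M.ρ (Z t ω).1 (Z t ω).2 s')) +
          M.γ * ∑ b, q t ω s' b * Q t ω s' b))) atTop (𝓝 l) := by
  classical
  set V : ℕ → Ω → S → ℝ := fun t ω s' => ∑ b, q t ω s' b * Q t ω s' b with hV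
  have hV_meas : ∀ t s', Measurable[ℱ t] fun ω => V t ω s' := fun t s' =>
    Finset.measurable_fun_sum _ fun b _ => (hq_meas t s' b).mul (hQ_meas t s' b)
  have hreward := hsample.ae_exists_tendsto_sum_noise (f := fun _ x => x)
    (fun _ => measurable_id) hr hc hsum
  have hnext := ae_all_iff.2 fun s' : S =>
    hsample.ae_exists_tendsto_sum_noise (f := fun y _ => if y = s' then 1 else 0)
      (fun _ => measurable_const) (C := 1)
      (fun t => .of_forall fun ω => by split_ifs <;> simp)
      (c := fun t ω => c t ω * V t ω s') (fun t => (hc t).mul (hV_meas t s')) (by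
        -- The bound `B` may depend on `ω`: only pathwise square summability of the coefficients is
        -- needed.
        filter_upwards [hsum, hQ_bdd] with ω h1 ⟨B, hB⟩
        refine .of_nonneg_of_le (fun t => sq_nonneg _) (fun t => ?_) (h1.mul_right (B ^ 2))
        rw [mul_pow]
        refine mul_le_mul_of_nonneg_left ?_ (sq_nonneg _)
        have := abs_sum_mul_le_of_mem_stdSimplex (hq_mem t ω s') (hB t s')
        exact sq_le_sq' (neg_le_of_abs_le this) (le_of_abs_le this))
  filter_upwards [hreward, hnext] with ω ⟨l, hl⟩ h2
  choose l' hl' using h2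
  refine ⟨l + M.γ * ∑ s', l' s',
    (hl.add ((tendsto_finsetSum Finset.univ fun s' _ => hl' s').const_mul M.γ)).congr fun n => ?_⟩
  have hprob : ∀ z : Σ s, A s, ∀ s' s'' : S,
      ∫ _, (if s'' = s' then (1 : ℝ) else 0) ∂(M.ρ z.1 z.2 s'') = if s'' = s' then 1 else 0 :=
    fun z s' s'' => by
      have := M.ρ_prob z.1 z.2 s''
      simp
  rw [Finset.sum_comm, Finset.mul_sum, ← Finset.sum_add_distrib]
  refine Finset.sum_congr rfl fun t _ => ?_
  have e : ∑ s', c t ω * V t ω s' * ((if Y t ω = s' then 1 else 0) -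
      ∑ s'', M.p (Z t ω).1 (Z t ω).2 s'' *
        ∫ _, (if s'' = s' then (1 : ℝ) else 0) ∂(M.ρ (Z t ω).1 (Z t ω).2 s'')) =
      c t ω * (V t ω (Y t ω) - ∑ s', M.p (Z t ω).1 (Z t ω).2 s' * V t ω s') := by
    simp only [hprob, mul_ite, mul_one, mul_zero, Finset.sum_ite_eq', Finset.mem_univ, if_true,
      mul_sub, Finset.sum_sub_distrib, Finset.sum_ite_eq, Finset.mul_sum]
    congr 1
    exact Finset.sum_congr rfl fun s' _ => by ring
  rw [e]
  simp only [mul_add, Finset.sum_add_distrib]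
  have e2 : ∑ s', M.p (Z t ω).1 (Z t ω).2 s' * (M.γ * V t ω s') =
      M.γ * ∑ s', M.p (Z t ω).1 (Z t ω).2 s' * V t ω s' := by
    rw [Finset.mul_sum]
    exact Finset.sum_congr rfl fun s' _ => by ring
  rw [e2]
  ring

end

theorem mainTheorem1 {S : Type*} [Fintype S] {A : S → Type*} [∀ s, Fintype (A s)]
    [∀ s, Nonempty (A s)] (M : FiniteMDP S A)
    {Ω : Type*} {mΩ : MeasurableSpace Ω} (μ : Measure Ω) [IsProbabilityMeasure μ]
    (ℱ : Filtration ℕ mΩ)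
    (Z : ℕ → Ω → (Σ s, A s)) (Y : ℕ → Ω → S) (r : ℕ → Ω → ℝ)
    (hsample : M.IsSampling μ ℱ Z Y r)
    (α : ℕ → Ω → (s : S) → A s → ℝ)
    (hα_meas : ∀ t s a, Measurable[ℱ t] (fun ω => α t ω s a))
    (hα_mem : ∀ᵐ ω ∂μ, ∀ t s a, α t ω s a ∈ Set.Icc (0 : ℝ) 1)
    (hα_sum : ∀ᵐ ω ∂μ, ∀ s a,
      Tendsto (fun n => ∑ t ∈ Finset.range n, appliedStep Z α t ω s a) atTop atTop)
    (hα_sq : ∀ᵐ ω ∂μ, ∀ s a, Summable (fun t => appliedStep Z α t ω s a ^ 2))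
    (q Q : ℕ → Ω → (s : S) → A s → ℝ)
    (hq_meas : ∀ t s a, Measurable[ℱ t] (fun ω => q t ω s a))
    (hq_mem : ∀ t ω s, q t ω s ∈ stdSimplex ℝ (A s))
    (hQ_zero : ∀ s a, Measurable[ℱ 0] (fun ω => Q 0 ω s a))
    (hQ : IsSmoothedQLearning M.γ Z Y r α q Q)
    (hq : ConcentratesOnGreedy μ q Q ∨ IsSharpeningSoftmax μ q Q ∨ IsClippedMax μ q Q) :
    (∃! Qs : (s : S) → A s → ℝ, M.IsOptimalQ Qs) ∧
      ∀ Qs : (s : S) → A s → ℝ, M.IsOptimalQ Qs →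
        ∀ᵐ ω ∂μ, ∀ s a, Tendsto (fun t => Q t ω s a) atTop (𝓝 (Qs s a)) := by
  refine ⟨M.existsUnique_isOptimalQ, fun Qs hQs => ?_⟩
  obtain ⟨R, hR⟩ := M.ρ_bounded
  have hr := hsample.ae_abs_reward_le hR
  have hbdd : ∀ᵐ ω ∂μ, ∃ B, ∀ t s a, |Q t ω s a| ≤ B := by
    filter_upwards [hα_mem, ae_all_iff.2 hr] with ω h1 h2
    exact hQ.exists_bound M.γ_nonneg M.γ_lt_one hq_mem h1 h2
  have hnoise := ae_all_iff.2 fun x : Σ s, A s =>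
    hsample.ae_exists_tendsto_sum_qLearning_noise hq_meas hq_mem
      (hQ.measurable hsample hα_meas hq_meas hQ_zero) hbdd hr
      (hsample.measurable_appliedStep hα_meas · x.1 x.2) (hα_sq.mono fun ω h => h x.1 x.2)
  filter_upwards [hα_mem, hα_sum, hbdd, ae_tendsto_smoothed_sub_max hq_mem hq hbdd, hnoise]
    with ω h1 h2 ⟨B, hB⟩ h3 h4
  exact hQ.tendsto_of_noise_summable hQs hB h1 h2 h3 fun s a => h4 ⟨s, a⟩
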